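/- Let $\mathcal V$ be a finite set (the vocabulary) and let $\mathcal U$ be the infinite rooted tree in which every node has exactly one child for each $x\in\mathcal V$; its nodes are the finite words over $\mathcal V$, the root $r$ being the empty word. To each node $u$ attach a random probability vector $(\beta_{ux})_{x\in\mathcal V}$ on $\mathcal V$, where $\beta_{ux}$ labels the edge from $u$ to its child $ux$, and assume that these vectors are independent and identically distributed over the nodes $u$. For a node $v$ let $P(v)$ be the product of the labels on the path from $r$ to $v$ (so $P(r)=1$), and let $V(v)=-\log P(v)\in[0,\infty]$ be its value in the log-probability tree. For $t\in\mathbb R$ let $N(t)=\#\{v\in\mathcal U: V(v)\le t\}$, and for an integer $P\ge 1$ let $T_P$ be the $P$-th smallest value, counted with multiplicity, among all $V(v)$, $v\in\mathcal U$ (root included), that is, the least $t$ with $N(t)\ge P$. Let $(\beta_x)_{x\in\mathcal V}$ be the vector at the root and put $$\mu=\mathbb E\Big[-\sum_{x\in\mathcal V}\beta_x\log\beta_x\Big],\qquad \mu_{(2)}=\mathbb E\Big[\sum_{x\in\mathcal V}\beta_x\log^2\beta_x\Big],$$ with $0\log 0=0\log^2 0=0$. Assume that $\mu>0$, that $\mu_{(2)}<\infty$,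 and that the point process $\Xi_{\log}=\{-\log\beta_x : x\in\mathcal V,\ \beta_x>0\}$ is non-arithmetic: there are no $\lambda>0$ and $c_0\in\mathbb R$ such that almost surely all points of $\Xi_{\log}$ lie in $c_0+\lambda\mathbb Z$. Then, for every $P\ge 2$, $T_P$ almost surely exists and is integrable, and $$\mathbb E[T_P]\ \ge\ \log P-\log\log P-O(1),$$ that is, there is a constant $C$, not depending on $P$, such that $\mathbb E[T_P]\ge \log P-\log\log P-C$ for all integers $P\ge 2$. -/

import Mathlib

open MeasureTheory ProbabilityTheory

noncomputable section

/-! A node of the token tree over the vocabulary `V` is a finite word, written with its most recent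
token first: `[]` is the root `r`, and the children of the node `u` are the words `x :: u`, `x : V`.
The tree is labelled by `β : List V → Ω → V → ℝ`, where `β u ω x` is the acceptance probability on
the edge from `u` to its child `x :: u`, that is, the probability that `x` is the token which
follows the prefix `u`. -/

/-- The standing model: the next-token distributions at the different nodes (prefixes) are random
probability vectors on the vocabulary, independent and identically distributed across the nodes.
(The coordinates of one such vector are in general dependent.) -/
structure IsIIDTokenTree {V Ω : Type*} [Fintype V] [MeasurableSpace Ω]
    (β : List V → Ω → V → ℝ) (prob : Measure Ω) : Prop where
  measurable : ∀ u, Measurable (β u)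
  mem_simplex : ∀ u, ∀ᵐ ω ∂prob, β u ω ∈ stdSimplex ℝ V
  indep : iIndepFun β prob
  ident : ∀ u, IdentDistrib (β u) (β []) prob prob

/-- The probability `P(v)` of a node: the product of the edge labels from the root to `v`. -/
def nodeProb {V : Type*} (b : List V → V → ℝ) : List V → ℝ
  | [] => 1
  | x :: u => nodeProb b u * b u x

/-- The value (position) `V(v) = -log P(v)` of a node in the log-probability tree; it is `+∞` when
`P(v) = 0`. -/
def nodeValue {V : Type*} (b : List V → V → ℝ) (v : List V) : EReal :=
  -ENNReal.log (ENNReal.ofReal (nodeProb b v))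

/-- `N(t)`: the number of nodes of the log-probability tree, the root included, of value `≤ t`. -/
def nodeCount {V : Type*} (b : List V → V → ℝ) (t : ℝ) : ℕ∞ :=
  {v : List V | nodeValue b v ≤ (t : EReal)}.encard

/-- `T_P`: the `P`-th smallest value, with multiplicity, in the log-probability tree: the least `t`
such that at least `P` nodes have value `≤ t`. -/
def orderedValue {V : Type*} (b : List V → V → ℝ) (P : ℕ) : ℝ :=
  sInf {t : ℝ | (P : ℕ∞) ≤ nodeCount b t}

/-- The (finite) points of the point process `Ξ_log = {-log β_x : x ∈ V}`; a token of probability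
`0` sits at `+∞` and contributes no point of the real line. -/
def logPoints {V : Type*} (p : V → ℝ) : Set ℝ :=
  {y | ∃ x, 0 < p x ∧ y = -Real.log (p x)}

/-- The point process `Ξ_log` of the random probability vector `p` is arithmetic: for some `s > 0`
and `c`, almost surely all its points lie in the grid `c + s ℤ`. -/
def IsArithmetic {V Ω : Type*} [MeasurableSpace Ω] (p : Ω → V → ℝ) (prob : Measure Ω) : Prop :=
  ∃ s c : ℝ, 0 < s ∧ ∀ᵐ ω ∂prob, ∀ y ∈ logPoints (p ω), ∃ k : ℤ, y = c + s * k

/-- The expected entropy `μ = E[-∑ β_x log β_x]`. -/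
def meanEntropy {V Ω : Type*} [Fintype V] [MeasurableSpace Ω] (p : Ω → V → ℝ)
    (prob : Measure Ω) : ℝ :=
  ∫ ω, -∑ x, p ω x * Real.log (p ω x) ∂prob

end

/-! The proof is a truncated first-moment bound. Write `T` for the `P`-th value. If `T ≤ a`, then
each of `P` nodes has `P(v) ≥ exp (-T)`, so `(a - T)⁺ ≤ exp (a - T) ≤ exp a * P(v)`; summing over
these nodes bounds `P * (a - T)⁺` by `exp a * ∑ P(v)`. Each level has total mass 1, so the levels
below `K` contribute at most `K`. At deeper levels `P(v)` is replaced by the larger `exp a *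
P(v)^2`, whose level sums have expectation `exp a * m^k` with `m = E[∑ β_x²]` (`lintegral_levelSq`).
Positive entropy forces `m < 1` (`meanSq_lt_one`), so this tail is geometric.

Taking `exp a = P / log P` and `K` of order `a`, just large enough to absorb the factor `exp a`,
gives `a - E[T] ≤ O(K / log P) = O(1)`. The core is `ofReal_sub_mul_le`, averaged in
`sub_integral_orderedValue_le`. -/

theorem nodeValue_le_iff {V : Type*} (b : List V → V → ℝ) (v : List V) (t : ℝ) :
    nodeValue b v ≤ (t : EReal) ↔ Real.exp (-t) ≤ nodeProb b v := by
  unfold nodeValue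
  rw [EReal.neg_le, ← EReal.coe_neg, ← EReal.log_exp (-t : ℝ),
    ENNReal.log_le_log_iff, EReal.exp_coe, ENNReal.ofReal_le_ofReal_iff', or_iff_left (Real.exp_pos _).not_ge]

theorem le_nodeCount_iff {V : Type*} (b : List V → V → ℝ) (P : ℕ) (t : ℝ) :
    (P : ℕ∞) ≤ nodeCount b t ↔
      ∃ F : Finset (List V), F.card = P ∧ ∀ v ∈ F, Real.exp (-t) ≤ nodeProb b v := by
  unfold nodeCount
  simp_rw [nodeValue_le_iff]
  constructor
  · intro h
    obtain ⟨s, hs, hc⟩ := Set.exists_subset_encard_eq h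
    have hf : s.Finite := Set.finite_of_encard_eq_coe hc
    refine ⟨hf.toFinset, ?_, fun v hv => hs (hf.mem_toFinset.1 hv)⟩
    rw [hf.encard_eq_coe_toFinset_card] at hc
    exact_mod_cast hc
  · rintro ⟨F, rfl, hF⟩
    rw [← Set.encard_coe_eq_coe_finsetCard]
    exact Set.encard_le_encard fun v hv => hF v hv

theorem nodeCount_mono {V : Type*} (b : List V → V → ℝ) : Monotone (nodeCount b) := fun _ _ hst =>
  Set.encard_le_encard fun _ hv => le_trans (Set.mem_ofPred.1 hv) (EReal.coe_le_coe_iff.2 hst)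

/-! ### Deterministic estimates for a fixed labelling -/

section Simplex

variable {V : Type*} [Fintype V] {b : List V → V → ℝ}

theorem nodeProb_nonneg (hb : ∀ u, b u ∈ stdSimplex ℝ V) : ∀ v, 0 ≤ nodeProb b v
  | [] => zero_le_one
  | x :: u => mul_nonneg (nodeProb_nonneg hb u) ((hb u).1 x)

theorem nodeProb_le_one (hb : ∀ u, b u ∈ stdSimplex ℝ V) : ∀ v, nodeProb b v ≤ 1
  | [] => le_rfl
  | x :: u => mul_le_one₀ (nodeProb_le_one hb u) ((hb u).1 x)
      ((Finset.single_le_sum (fun i _ => (hb u).1 i) (Finset.mem_univ x)).trans_eq (hb u).2)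

theorem sum_ofFn_succ {M : Type*} [AddCommMonoid M] (k : ℕ) (g : List V → M) :
    ∑ f : Fin (k + 1) → V, g (List.ofFn f) = ∑ f : Fin k → V, ∑ x, g (x :: List.ofFn f) := by
  rw [← (Fin.consEquiv fun _ => V).sum_comp, Fintype.sum_prod_type_right]
  simp [Fin.consEquiv]

theorem sum_level_nodeProb (hb : ∀ u, b u ∈ stdSimplex ℝ V) (k : ℕ) :
    ∑ f : Fin k → V, nodeProb b (List.ofFn f) = 1 := by
  induction k with
  | zero => simp [nodeProb]
  | succ k ih =>
    rw [sum_ofFn_succ, ← ih]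
    refine Finset.sum_congr rfl fun f _ => ?_
    simp only [nodeProb]
    rw [← Finset.mul_sum, (hb _).2, mul_one]

/-- The sum of `P(v)²` over the nodes `v` of level `k`. -/
noncomputable def levelSq (b : List V → V → ℝ) (k : ℕ) : ENNReal :=
  ∑ f : Fin k → V, ENNReal.ofReal (nodeProb b (List.ofFn f) ^ 2)

theorem tsum_list_eq (g : List V → ENNReal) :
    ∑' v, g v = ∑' k, ∑ f : Fin k → V, g (List.ofFn f) := by
  rw [← List.equivSigmaTuple.symm.tsum_eq, ENNReal.tsum_sigma']
  simp [List.equivSigmaTuple, tsum_fintype]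

/-- A convergent sum of squares has only finitely many terms above `exp (-t) ^ 2`. -/
theorem finite_setOf_nodeValue_le (hs : ∑' k, levelSq b k ≠ ⊤) (t : ℝ) :
    {v | nodeValue b v ≤ (t : EReal)}.Finite := by
  simp only [levelSq] at hs
  rw [← tsum_list_eq (fun v => ENNReal.ofReal (nodeProb b v ^ 2))] at hs
  refine (ENNReal.finite_const_le_of_tsum_ne_top hs
    (ε := ENNReal.ofReal (Real.exp (-t) ^ 2)) (by simp)).subset fun v hv => ?_
  rw [Set.mem_ofPred, nodeValue_le_iff] at hv
  exact ENNReal.ofReal_le_ofReal (by gcongr)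

theorem exists_child_ge (hb : ∀ u, b u ∈ stdSimplex ℝ V) (u : List V) :
    ∃ x, (Fintype.card V : ℝ)⁻¹ ≤ b u x := by
  by_contra! h
  have hV : Nonempty V := by
    by_contra hV
    rw [not_nonempty_iff] at hV
    simpa using (hb u).2
  have h1 : ∑ x, b u x < ∑ _x : V, (Fintype.card V : ℝ)⁻¹ :=
    Finset.sum_lt_sum_of_nonempty Finset.univ_nonempty fun x _ => h x
  rw [(hb u).2, Finset.sum_const, Finset.card_univ, nsmul_eq_mul,
    mul_inv_cancel₀ (by positivity)] at h1
  exact lt_irrefl _ h1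

theorem exists_node_ge (hb : ∀ u, b u ∈ stdSimplex ℝ V) (k : ℕ) :
    ∃ v : List V, v.length = k ∧ (Fintype.card V : ℝ)⁻¹ ^ k ≤ nodeProb b v := by
  induction k with
  | zero => exact ⟨[], rfl, by simp [nodeProb]⟩
  | succ k ih =>
    obtain ⟨u, hu, h⟩ := ih
    obtain ⟨x, hx⟩ := exists_child_ge hb u
    exact ⟨x :: u, by simp [hu], by
      rw [pow_succ]
      exact mul_le_mul h hx (by positivity) (nodeProb_nonneg hb u)⟩

/-- Some child always has label at least `1 / |V|`, so each of the levels `0, …, P - 1` supplies one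
node of small enough value. This deterministic bound on the `P`-th value yields integrability. -/
theorem le_nodeCount_mul_log_card (hb : ∀ u, b u ∈ stdSimplex ℝ V) (P : ℕ) :
    (P : ℕ∞) ≤ nodeCount b (P * Real.log (Fintype.card V)) := by
  have hV : Nonempty V := by
    obtain ⟨x, -⟩ := exists_child_ge hb []
    exact ⟨x⟩
  have hc : (1 : ℝ) ≤ Fintype.card V := by exact_mod_cast Fintype.card_pos
  choose v hv hp using exists_node_ge hb
  have hinj : Function.Injective v := fun i j hij => by rw [← hv i, ← hv j, hij]
  rw [le_nodeCount_iff]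
  refine ⟨(Finset.range P).map ⟨v, hinj⟩, by simp, ?_⟩
  simp only [Finset.mem_map, Finset.mem_range, Function.Embedding.coeFn_mk]
  rintro _ ⟨k, hk, rfl⟩
  refine le_trans ?_ (hp k)
  rw [Real.exp_neg, Real.exp_nat_mul, Real.exp_log (by linarith), ← inv_pow]
  exact pow_le_pow_of_le_one (by positivity) (inv_le_one_of_one_le₀ hc) hk.le

theorem nonneg_of_le_nodeCount (hb : ∀ u, b u ∈ stdSimplex ℝ V) {P : ℕ} (hP : 0 < P) {t : ℝ}
    (h : (P : ℕ∞) ≤ nodeCount b t) : 0 ≤ t := by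
  obtain ⟨F, rfl, hF⟩ := (le_nodeCount_iff b P t).1 h
  obtain ⟨v, hv⟩ := Finset.card_pos.1 hP
  have := (hF v hv).trans (nodeProb_le_one hb v)
  rw [Real.exp_le_one_iff] at this
  linarith

theorem isLeast_orderedValue (hb : ∀ u, b u ∈ stdSimplex ℝ V) (hs : ∑' k, levelSq b k ≠ ⊤) {P : ℕ}
    (hP : 0 < P) : IsLeast {t : ℝ | (P : ℕ∞) ≤ nodeCount b t} (orderedValue b P) := by
  have hbdd : BddBelow {t : ℝ | (P : ℕ∞) ≤ nodeCount b t} :=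
    ⟨0, fun t ht => nonneg_of_le_nodeCount hb hP ht⟩
  refine ⟨?_, fun t ht => csInf_le hbdd ht⟩
  set T := orderedValue b P with hT
  -- Only finitely many values lie below `T + 1`, so the count does not jump immediately to the
  -- right of `T`; hence the infimum is attained.
  have hev : ∀ᶠ t : ℝ in nhdsWithin T (Set.Ioi T), ∀ v ∈ {v | nodeValue b v ≤ ((T + 1 : ℝ) : EReal)},
      nodeValue b v ≤ (t : EReal) → nodeValue b v ≤ (T : EReal) := by
    rw [Filter.eventually_all_finite (finite_setOf_nodeValue_le hs _)]
    intro v _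
    by_cases hv : nodeValue b v ≤ (T : EReal)
    · exact .of_forall fun _ _ => hv
    · have : ∀ᶠ t : ℝ in nhds T, (t : EReal) < nodeValue b v :=
        continuous_coe_real_ereal.continuousAt.eventually_lt_const (not_le.1 hv)
      filter_upwards [nhdsWithin_le_nhds this] with t ht h
      exact absurd h (not_le.2 ht)
  have hlt : ∀ᶠ t : ℝ in nhdsWithin T (Set.Ioi T), t < T + 1 :=
    nhdsWithin_le_nhds (Iio_mem_nhds (lt_add_one T))
  have hgt : ∀ᶠ t : ℝ in nhdsWithin T (Set.Ioi T), T < t := self_mem_nhdsWithin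
  obtain ⟨t, ht, ht1, hTt⟩ := (hev.and (hlt.and hgt)).exists
  obtain ⟨s, hs', hst⟩ := exists_lt_of_csInf_lt
    (s := {t : ℝ | (P : ℕ∞) ≤ nodeCount b t}) ⟨_, le_nodeCount_mul_log_card hb P⟩ hTt
  refine (Set.mem_ofPred.1 hs').trans ((nodeCount_mono b hst.le).trans
    (Set.encard_le_encard fun v hv => ?_))
  exact ht v (le_trans (Set.mem_ofPred.1 hv) (EReal.coe_le_coe_iff.2 ht1.le)) hv

theorem ofReal_sub_mul_le (hb : ∀ u, b u ∈ stdSimplex ℝ V) {P : ℕ} {T : ℝ}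
    (h : (P : ℕ∞) ≤ nodeCount b T) (a : ℝ) (K : ℕ) :
    ENNReal.ofReal (a - T) * P ≤ ENNReal.ofReal (Real.exp a) *
      (K + ENNReal.ofReal (Real.exp a) * ∑' k, levelSq b (k + K)) := by
  rcases le_total a T with haT | haT
  · simp [ENNReal.ofReal_of_nonpos (sub_nonpos.2 haT)]
  obtain ⟨F, rfl, hF⟩ := (le_nodeCount_iff b P T).1 h
  -- The weight is `P(v)` at shallow levels and `exp a * P(v)^2` at deep ones; it dominates `P(v)`
  -- on `F` because `exp a * P(v) ≥ 1` there.
  set g : List V → ENNReal := fun v => if v.length < K then ENNReal.ofReal (nodeProb b v) else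
    ENNReal.ofReal (Real.exp a) * ENNReal.ofReal (nodeProb b v ^ 2) with hg
  have h1 : ∀ v ∈ F, ENNReal.ofReal (a - T) ≤ ENNReal.ofReal (Real.exp a) * g v := by
    intro v hv
    have hv' := hF v hv
    have hp := nodeProb_nonneg hb v
    have hgv : ENNReal.ofReal (nodeProb b v) ≤ g v := by
      simp only [hg]
      split_ifs
      · exact le_rfl
      · rw [← ENNReal.ofReal_mul (Real.exp_nonneg _)]
        refine ENNReal.ofReal_le_ofReal ?_
        have : 1 ≤ Real.exp a * nodeProb b v := calc
          (1 : ℝ) = Real.exp a * Real.exp (-a) := by rw [← Real.exp_add]; simp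
          _ ≤ _ := by gcongr; exact (Real.exp_le_exp.2 (by linarith)).trans hv'
        nlinarith
    refine le_trans ?_ (mul_le_mul_right hgv _)
    rw [← ENNReal.ofReal_mul (Real.exp_nonneg _)]
    refine ENNReal.ofReal_le_ofReal ?_
    calc a - T ≤ Real.exp (a - T) := by linarith [Real.add_one_le_exp (a - T)]
      _ = Real.exp a * Real.exp (-T) := by rw [← Real.exp_add, sub_eq_add_neg]
      _ ≤ _ := by gcongr
  have h2 : ∑' v, g v = K + ENNReal.ofReal (Real.exp a) * ∑' k, levelSq b (k + K) := by
    rw [tsum_list_eq, ← ENNReal.summable.sum_add_tsum_nat_add' (k := K), ← ENNReal.tsum_mul_left]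
    congr 1
    · rw [Finset.sum_congr rfl (g := fun _ => (1 : ENNReal))]
      · simp
      · intro k hk
        simp only [hg, List.length_ofFn, Finset.mem_range.1 hk, if_true]
        rw [← ENNReal.ofReal_sum_of_nonneg fun _ _ => nodeProb_nonneg hb _, sum_level_nodeProb hb]
        simp
    · refine tsum_congr fun k => ?_
      simp [hg, levelSq, Finset.mul_sum]
  calc ENNReal.ofReal (a - T) * F.card = ∑ v ∈ F, ENNReal.ofReal (a - T) := by
        rw [Finset.sum_const, nsmul_eq_mul, mul_comm]
    _ ≤ ∑ v ∈ F, ENNReal.ofReal (Real.exp a) * g v := Finset.sum_le_sum h1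
    _ = ENNReal.ofReal (Real.exp a) * ∑ v ∈ F, g v := by rw [Finset.mul_sum]
    _ ≤ _ := by rw [← h2]; gcongr; exact ENNReal.sum_le_tsum F

end Simplex

/-! ### Measurability, independence and expectations -/

theorem measurable_nodeProb {V Ω : Type*} {β : List V → Ω → V → ℝ} (m : MeasurableSpace Ω) :
    ∀ v : List V, (∀ u : List V, u.length < v.length → Measurable[m] (β u)) →
      Measurable[m] fun ω => nodeProb (fun u => β u ω) v
  | [], _ => measurable_const
  | x :: u, h => by
    have h1 := measurable_nodeProb m u fun w hw => h w (by simp; omega)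
    have h2 : Measurable[m] fun ω => β u ω x := (measurable_pi_apply x).comp (h u (by simp))
    exact h1.mul h2

section Tree

variable {V Ω : Type*} [Fintype V] [MeasurableSpace Ω] {prob : Measure Ω}
  {β : List V → Ω → V → ℝ}

/-- The expected sum of squares `E[∑ β_x²]` of a random vector. -/
noncomputable def meanSq (p : Ω → V → ℝ) (prob : Measure Ω) : ENNReal :=
  ∑ x, ∫⁻ ω, ENNReal.ofReal (p ω x ^ 2) ∂prob

/-- `P(u)` depends only on the vectors at words strictly shorter than `u`, hence is independent of
the vector at `u`. -/
theorem lintegral_nodeProb_cons_sq (hβ : IsIIDTokenTree β prob) (u : List V) (x : V) :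
    ∫⁻ ω, ENNReal.ofReal (nodeProb (fun u => β u ω) (x :: u) ^ 2) ∂prob =
      (∫⁻ ω, ENNReal.ofReal (nodeProb (fun u => β u ω) u ^ 2) ∂prob) *
        ∫⁻ ω, ENNReal.ofReal (β [] ω x ^ 2) ∂prob := by
  have hle : ∀ v, MeasurableSpace.comap (β v) inferInstance ≤ ‹MeasurableSpace Ω› :=
    fun v => (hβ.measurable v).comap_le
  have hind := indep_iSup_of_disjoint hle hβ.indep
    (S := {v : List V | v.length < u.length}) (T := {u}) (by simp)
  have hf : Measurable[⨆ v ∈ {v : List V | v.length < u.length},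
      MeasurableSpace.comap (β v) inferInstance]
      fun ω => ENNReal.ofReal (nodeProb (fun u => β u ω) u ^ 2) := by
    refine ENNReal.measurable_ofReal.comp (Measurable.pow_const (measurable_nodeProb _ u ?_) 2)
    intro w hw
    exact (comap_measurable (β w)).mono (le_iSup₂_of_le w hw le_rfl) le_rfl
  have hg : Measurable[⨆ v ∈ ({u} : Set (List V)), MeasurableSpace.comap (β v) inferInstance]
      fun ω => ENNReal.ofReal (β u ω x ^ 2) := by
    refine ENNReal.measurable_ofReal.comp (Measurable.pow_const ?_ 2)
    exact (measurable_pi_apply x).comp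
      ((comap_measurable (β u)).mono (le_iSup₂_of_le u rfl le_rfl) le_rfl)
  have hid : ∫⁻ ω, ENNReal.ofReal (β u ω x ^ 2) ∂prob =
      ∫⁻ ω, ENNReal.ofReal (β [] ω x ^ 2) ∂prob :=
    ((hβ.ident u).comp (u := fun p : V → ℝ => ENNReal.ofReal (p x ^ 2))
      (by fun_prop)).lintegral_eq
  rw [← hid, ← lintegral_mul_eq_lintegral_mul_lintegral_of_independent_measurableSpace
    (iSup₂_le fun v _ => hle v) (iSup₂_le fun v _ => hle v) hind hf hg]
  refine lintegral_congr fun ω => ?_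
  rw [← ENNReal.ofReal_mul (sq_nonneg _), ← mul_pow]
  rfl

theorem IsIIDTokenTree.measurable_nodeProb (hβ : IsIIDTokenTree β prob) (v : List V) :
    Measurable fun ω => nodeProb (fun u => β u ω) v :=
  _root_.measurable_nodeProb _ v fun u _ => hβ.measurable u

theorem ae_mem_simplex (hβ : IsIIDTokenTree β prob) :
    ∀ᵐ ω ∂prob, ∀ u, β u ω ∈ stdSimplex ℝ V :=
  ae_all_iff.2 hβ.mem_simplex

theorem measurable_levelSq (hβ : IsIIDTokenTree β prob) (k : ℕ) :
    Measurable fun ω => levelSq (fun u => β u ω) k :=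
  Finset.measurable_sum _ fun _ _ =>
    ENNReal.measurable_ofReal.comp ((hβ.measurable_nodeProb _).pow_const 2)

theorem measurableSet_le_nodeCount (hβ : IsIIDTokenTree β prob) (P : ℕ) (t : ℝ) :
    MeasurableSet {ω | (P : ℕ∞) ≤ nodeCount (fun u => β u ω) t} := by
  simp_rw [le_nodeCount_iff]
  have : {ω | ∃ F : Finset (List V), F.card = P ∧
      ∀ v ∈ F, Real.exp (-t) ≤ nodeProb (fun u => β u ω) v} =
      ⋃ F : Finset (List V), ⋃ _ : F.card = P, ⋂ v ∈ F,
        {ω | Real.exp (-t) ≤ nodeProb (fun u => β u ω) v} := by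
    ext ω; simp
  rw [this]
  exact .iUnion fun F => .iUnion fun _ => Finset.measurableSet_biInter _ fun v _ =>
    measurableSet_le measurable_const (hβ.measurable_nodeProb v)

variable [IsProbabilityMeasure prob]

theorem lintegral_levelSq (hβ : IsIIDTokenTree β prob) (k : ℕ) :
    ∫⁻ ω, levelSq (fun u => β u ω) k ∂prob = meanSq (β []) prob ^ k := by
  have h : ∀ k, ∫⁻ ω, levelSq (fun u => β u ω) k ∂prob = ∑ f : Fin k → V,
      ∫⁻ ω, ENNReal.ofReal (nodeProb (fun u => β u ω) (List.ofFn f) ^ 2) ∂prob := fun k =>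
    lintegral_finsetSum _ fun f _ =>
      ENNReal.measurable_ofReal.comp ((hβ.measurable_nodeProb _).pow_const 2)
  induction k with
  | zero => simp [levelSq, nodeProb]
  | succ k ih =>
    rw [h, sum_ofFn_succ (g := fun v =>
      ∫⁻ ω, ENNReal.ofReal (nodeProb (fun u => β u ω) v ^ 2) ∂prob), pow_succ, ← ih, h,
      Finset.sum_mul]
    refine Finset.sum_congr rfl fun f _ => ?_
    rw [meanSq, Finset.mul_sum]
    exact Finset.sum_congr rfl fun x _ => lintegral_nodeProb_cons_sq hβ _ x

/-- Since `∑ β_x² ≤ ∑ β_x = 1`, mean 1 would force equality almost surely; every label would then be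
0 or 1 and the entropy would vanish. -/
theorem meanSq_lt_one (hβ : IsIIDTokenTree β prob) (hμ : 0 < meanEntropy (β []) prob) :
    meanSq (β []) prob < 1 := by
  by_contra! hge
  have hm : ∀ x, Measurable fun ω => ENNReal.ofReal (β [] ω x ^ 2) := fun x =>
    ENNReal.measurable_ofReal.comp (((measurable_pi_apply x).comp (hβ.measurable [])).pow_const 2)
  have hle : ∀ p ∈ stdSimplex ℝ V, ∀ x, p x ≤ 1 := fun p hp x =>
    (Finset.single_le_sum (fun i _ => hp.1 i) (Finset.mem_univ x)).trans_eq hp.2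
  rw [meanSq, ← lintegral_finsetSum _ fun x _ => hm x] at hge
  have hae : (fun ω => ∑ x, ENNReal.ofReal (β [] ω x ^ 2)) =ᵐ[prob] fun _ => 1 := by
    refine ae_eq_of_ae_le_of_lintegral_le ?_ ?_ aemeasurable_const (by simpa using hge)
    · filter_upwards [hβ.mem_simplex []] with ω hω
      rw [← ENNReal.ofReal_sum_of_nonneg fun _ _ => sq_nonneg _, ← ENNReal.ofReal_one, ← hω.2]
      refine ENNReal.ofReal_le_ofReal (Finset.sum_le_sum fun x _ => ?_)
      nlinarith [hω.1 x, hle _ hω x]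
    · refine ne_of_lt (lt_of_le_of_lt (lintegral_mono_ae (g := fun _ => 1) ?_) (by simp))
      filter_upwards [hβ.mem_simplex []] with ω hω
      rw [← ENNReal.ofReal_sum_of_nonneg fun _ _ => sq_nonneg _, ← ENNReal.ofReal_one, ← hω.2]
      refine ENNReal.ofReal_le_ofReal (Finset.sum_le_sum fun x _ => ?_)
      nlinarith [hω.1 x, hle _ hω x]
  refine hμ.ne' (integral_eq_zero_of_ae ?_)
  filter_upwards [hae, hβ.mem_simplex []] with ω h hω
  rw [← ENNReal.ofReal_sum_of_nonneg fun _ _ => sq_nonneg _, ENNReal.ofReal_eq_one] at h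
  have h0 : ∑ x, (β [] ω x - β [] ω x ^ 2) = 0 := by rw [Finset.sum_sub_distrib, h, hω.2, sub_self]
  rw [Finset.sum_eq_zero_iff_of_nonneg fun x _ => by nlinarith [hω.1 x, hle _ hω x]] at h0
  rw [Pi.zero_apply, neg_eq_zero]
  refine Finset.sum_eq_zero fun x hx => ?_
  have h1 : β [] ω x * (1 - β [] ω x) = 0 := by linarith [h0 x hx]
  rcases mul_eq_zero.1 h1 with h2 | h2
  · simp [h2]
  · simp [show β [] ω x = 1 by linarith]

theorem lintegral_tsum_levelSq (hβ : IsIIDTokenTree β prob) (K : ℕ) :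
    ∫⁻ ω, ∑' k, levelSq (fun u => β u ω) (k + K) ∂prob =
      meanSq (β []) prob ^ K * (1 - meanSq (β []) prob)⁻¹ := by
  rw [lintegral_tsum fun k => (measurable_levelSq hβ _).aemeasurable]
  simp_rw [lintegral_levelSq hβ, pow_add, ENNReal.tsum_mul_right, ENNReal.tsum_geometric]
  rw [mul_comm]

theorem ae_tsum_levelSq_ne_top (hβ : IsIIDTokenTree β prob) (hμ : 0 < meanEntropy (β []) prob) :
    ∀ᵐ ω ∂prob, ∑' k, levelSq (fun u => β u ω) k ≠ ⊤ := by
  have h := lintegral_tsum_levelSq hβ 0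
  simp only [add_zero, pow_zero, one_mul] at h
  refine (ae_lt_top (Measurable.tsum fun k => measurable_levelSq hβ k) ?_).mono
    fun _ h => h.ne
  rw [h]
  exact ENNReal.inv_ne_top.2 (tsub_pos_of_lt (meanSq_lt_one hβ hμ)).ne'

theorem ae_isLeast_orderedValue (hβ : IsIIDTokenTree β prob) (hμ : 0 < meanEntropy (β []) prob)
    {P : ℕ} (hP : 0 < P) :
    ∀ᵐ ω ∂prob, IsLeast {t : ℝ | (P : ℕ∞) ≤ nodeCount (fun u => β u ω) t}
      (orderedValue (fun u => β u ω) P) := by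
  filter_upwards [ae_mem_simplex hβ, ae_tsum_levelSq_ne_top hβ hμ] with ω h1 h2
  exact isLeast_orderedValue h1 h2 hP

theorem aemeasurable_orderedValue (hβ : IsIIDTokenTree β prob)
    (hμ : 0 < meanEntropy (β []) prob) {P : ℕ} (hP : 0 < P) :
    AEMeasurable (fun ω => orderedValue (fun u => β u ω) P) prob := by
  refine NullMeasurable.aemeasurable ?_
  -- Almost surely the event `T ≤ t` is the measurable event that the count at `t` is at least `P`.
  refine @measurable_of_Iic ℝ (NullMeasurableSpace Ω prob) _ _ _ _ _ _ _ _ fun t => ?_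
  refine NullMeasurableSet.congr (measurableSet_le_nodeCount hβ P t).nullMeasurableSet ?_
  filter_upwards [ae_isLeast_orderedValue hβ hμ hP] with ω hω
  exact propext ⟨fun h => hω.2 h, fun h => (Set.mem_ofPred.1 hω.1).trans (nodeCount_mono _ h)⟩

theorem integrable_orderedValue (hβ : IsIIDTokenTree β prob)
    (hμ : 0 < meanEntropy (β []) prob) {P : ℕ} (hP : 0 < P) :
    Integrable (fun ω => orderedValue (fun u => β u ω) P) prob := by
  refine Integrable.of_bound (aemeasurable_orderedValue hβ hμ hP).aestronglyMeasurable
    (P * Real.log (Fintype.card V)) ?_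
  filter_upwards [ae_mem_simplex hβ, ae_isLeast_orderedValue hβ hμ hP] with ω h1 h2
  rw [Real.norm_of_nonneg (nonneg_of_le_nodeCount h1 hP h2.1)]
  exact h2.2 (le_nodeCount_mul_log_card h1 P)

theorem lintegral_sub_orderedValue_le (hβ : IsIIDTokenTree β prob)
    (hμ : 0 < meanEntropy (β []) prob) {P : ℕ} (hP : 0 < P) (a : ℝ) (K : ℕ) :
    (∫⁻ ω, ENNReal.ofReal (a - orderedValue (fun u => β u ω) P) ∂prob) * P ≤
      ENNReal.ofReal (Real.exp a) * (K + ENNReal.ofReal (Real.exp a) *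
        (meanSq (β []) prob ^ K * (1 - meanSq (β []) prob)⁻¹)) := by
  rw [← lintegral_tsum_levelSq hβ, ← lintegral_mul_const' _ _ (by simp),
    ← lintegral_const_mul' _ _ (by simp)]
  calc _ ≤ ∫⁻ ω, ENNReal.ofReal (Real.exp a) * (K + ENNReal.ofReal (Real.exp a) *
        ∑' k, levelSq (fun u => β u ω) (k + K)) ∂prob := by
        refine lintegral_mono_ae ?_
        filter_upwards [ae_mem_simplex hβ, ae_isLeast_orderedValue hβ hμ hP] with ω h1 h2
        exact ofReal_sub_mul_le h1 h2.1 a K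
    _ = _ := by
        rw [lintegral_const_mul' _ _ (by simp), lintegral_add_left measurable_const]
        simp

theorem sub_integral_orderedValue_le (hβ : IsIIDTokenTree β prob)
    (hμ : 0 < meanEntropy (β []) prob) {P : ℕ} (hP : 0 < P) (a : ℝ) (K : ℕ) {q : ℝ}
    (hq : meanSq (β []) prob ≤ ENNReal.ofReal q) (hq0 : 0 ≤ q) (hq1 : q < 1) :
    (a - ∫ ω, orderedValue (fun u => β u ω) P ∂prob) * P ≤
      Real.exp a * (K + Real.exp a * (q ^ K * (1 - q)⁻¹)) := by
  have hT := integrable_orderedValue hβ hμ hP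
  have h := lintegral_sub_orderedValue_le hβ hμ hP a K
  have hrhs : ENNReal.ofReal (Real.exp a) * (K + ENNReal.ofReal (Real.exp a) *
        (meanSq (β []) prob ^ K * (1 - meanSq (β []) prob)⁻¹)) ≤
      ENNReal.ofReal (Real.exp a * (K + Real.exp a * (q ^ K * (1 - q)⁻¹))) := by
    have h1q : 0 < 1 - q := sub_pos.2 hq1
    rw [ENNReal.ofReal_mul (by positivity), ENNReal.ofReal_add (by positivity) (by positivity),
      ENNReal.ofReal_mul (by positivity), ENNReal.ofReal_mul (by positivity),
      ENNReal.ofReal_pow hq0, ENNReal.ofReal_inv_of_pos h1q, ENNReal.ofReal_sub _ hq0,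
      ENNReal.ofReal_one, ENNReal.ofReal_natCast]
    gcongr
  -- The mean is at most the mean of the positive part.
  have hint : a - ∫ ω, orderedValue (fun u => β u ω) P ∂prob ≤
      (∫⁻ ω, ENNReal.ofReal (a - orderedValue (fun u => β u ω) P) ∂prob).toReal := by
    have hi : Integrable (fun ω => a - orderedValue (fun u => β u ω) P) prob :=
      (integrable_const a).sub hT
    calc _ = ∫ ω, (a - orderedValue (fun u => β u ω) P) ∂prob := by
          rw [integral_sub (integrable_const a) hT]; simp
      _ ≤ _ := by
          rw [integral_eq_lintegral_pos_part_sub_lintegral_neg_part hi]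
          exact sub_le_self _ ENNReal.toReal_nonneg
  have h2 := ENNReal.toReal_mono ENNReal.ofReal_ne_top (h.trans hrhs)
  have h1q : 0 < 1 - q := sub_pos.2 hq1
  rw [ENNReal.toReal_mul, ENNReal.toReal_natCast, ENNReal.toReal_ofReal (by positivity)] at h2
  exact le_trans (by gcongr) h2

end Tree

/-! ### Choice of `a` and `K`, and the final bound -/

theorem mainTheorem8 {V Ω : Type*} [Fintype V] [MeasurableSpace Ω]
    (prob : Measure Ω) [IsProbabilityMeasure prob] (β : List V → Ω → V → ℝ)
    (hβ : IsIIDTokenTree β prob)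
    -- `μ > 0`
    (hμ : 0 < meanEntropy (β []) prob)
    -- `μ₍₂₎ = E[∑ β_x log² β_x] < ∞`
    (hμ2 : Integrable (fun ω => ∑ x, β [] ω x * Real.log (β [] ω x) ^ 2) prob)
    (hna : ¬ IsArithmetic (β []) prob) :
    ∃ C : ℝ, ∀ P : ℕ, 2 ≤ P →
      -- the `P`-th smallest value exists almost surely, it is integrable, and the bound holds
      (∀ᵐ ω ∂prob, IsLeast {t : ℝ | (P : ℕ∞) ≤ nodeCount (fun u => β u ω) t}
        (orderedValue (fun u => β u ω) P)) ∧
      Integrable (fun ω => orderedValue (fun u => β u ω) P) prob ∧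
      Real.log P - Real.log (Real.log P) - C
        ≤ ∫ ω, orderedValue (fun u => β u ω) P ∂prob := by
  obtain ⟨q, hq, hq1⟩ := ENNReal.lt_iff_exists_nnreal_btwn.1 (meanSq_lt_one hβ hμ)
  have hq0 : 0 < (q : ℝ) := by
    exact_mod_cast (zero_le : (0 : ENNReal) ≤ meanSq (β []) prob).trans_lt hq
  have hq1' : (q : ℝ) < 1 := by exact_mod_cast hq1
  set L : ℝ := -Real.log q with hL
  have hLpos : 0 < L := neg_pos.2 (Real.log_neg hq0 hq1')
  -- The 1 pays for rounding `a / L` up to `K`, the other term for the geometric tail.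
  set D : ℝ := 1 + (1 - (q : ℝ))⁻¹ with hD
  have hDpos : 0 < D := by have := sub_pos.2 hq1'; positivity
  refine ⟨L⁻¹ + (L⁻¹ + D) / Real.log 2, fun P hP => ?_⟩
  have hP0 : 0 < P := by omega
  have hPpos : (0 : ℝ) < P := by exact_mod_cast hP0
  refine ⟨ae_isLeast_orderedValue hβ hμ hP0, integrable_orderedValue hβ hμ hP0, ?_⟩
  have hl2 : 0 < Real.log 2 := Real.log_pos one_lt_two
  have hlP : Real.log 2 ≤ Real.log P := Real.log_le_log two_pos (by exact_mod_cast hP)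
  have hlP0 : 0 < Real.log P := hl2.trans_le hlP
  set a : ℝ := Real.log P - Real.log (Real.log P) with ha
  have hea : Real.exp a = P / Real.log P := by
    rw [ha, Real.exp_sub, Real.exp_log hPpos, Real.exp_log hlP0]
  -- The extra 1 is needed since `log (log P) < 0` at `P = 2`.
  have ha1 : a ≤ Real.log P + 1 := by
    have h1 := Real.one_sub_inv_le_log_of_pos hlP0
    have h2 : (Real.log P)⁻¹ ≤ 2 := by
      rw [inv_le_comm₀ hlP0 two_pos]
      linarith [Real.log_two_gt_d9]
    linarith
  have ha0 : 0 ≤ a := by linarith [Real.log_le_sub_one_of_pos hlP0]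
  have hK := Nat.ceil_lt_add_one (a := a / L) (by positivity)
  have hK' := Nat.le_ceil (a / L)
  set K := ⌈a / L⌉₊
  -- This is why `K` is `a / L` rounded up: `q ^ K = exp (-(K * L))`.
  have hqK : Real.exp a * (q : ℝ) ^ K ≤ 1 := by
    have h1 : (q : ℝ) ^ K = Real.exp (-(K * L)) := by
      rw [hL, mul_neg, neg_neg, Real.exp_nat_mul, Real.exp_log hq0]
    rw [h1, ← Real.exp_add, Real.exp_le_one_iff]
    have := (div_le_iff₀ hLpos).1 hK'
    linarith
  have hmain := sub_integral_orderedValue_le hβ hμ hP0 a K (q := q) (by simpa using hq.le) hq0.le hq1'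
  set I := ∫ ω, orderedValue (fun u => β u ω) P ∂prob
  have h1 : (a - I) * P ≤ P / Real.log P * (a / L + D) := by
    refine hmain.trans ?_
    rw [hea] at hqK ⊢
    have : 0 < 1 - (q : ℝ) := sub_pos.2 hq1'
    refine mul_le_mul_of_nonneg_left ?_ (by positivity)
    have h3 := mul_le_mul_of_nonneg_right hqK (inv_nonneg.2 this.le)
    rw [hD]
    linarith
  have h2 : a - I ≤ (a / L + D) / Real.log P := by
    rw [← mul_le_mul_iff_left₀ hPpos]
    exact h1.trans_eq (by ring)
  have h3 : (a / L + D) / Real.log P ≤ ((Real.log P + 1) / L + D) / Real.log P := by gcongr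
  have h4 : ((Real.log P + 1) / L + D) / Real.log P = L⁻¹ + (L⁻¹ + D) / Real.log P := by
    field_simp
    ring
  have h5 : (L⁻¹ + D) / Real.log P ≤ (L⁻¹ + D) / Real.log 2 := by gcongr
  linarith
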